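/- Let $D_0,D_1,\dots,D_N\subset\mathbb R^2$ be bounded simply connected domains with smooth boundaries $\Gamma_i=\partial D_i$, such that $\bar D_i\subset D_0$ for $1\le i\le N$ and $\bar D_i\cap\bar D_j=\varnothing$ for $1\le i\neq j\le N$. Let $D=D_0\setminus\bigcup_{i=1}^N\bar D_i$, and let $\mathbf n$ be the unit normal on $\partial D$ pointing out of $D$. For $1\le i\le N$ let $\zeta_i\in C^\infty(\bar D)$ be the solution of $\Delta\zeta_i=0$ in $D$, $\zeta_i=1$ on $\Gamma_i$ and $\zeta_i=0$ on $\Gamma_j$ for all $j\in\{0,\dots,N\}$ with $j\ne i$. Define $$\mathcal X=\Big\{u\in H^1(D)\;\Big|\; u=v+\sum_{i=1}^N\theta_i\zeta_i,\ v\in H^1_0(D),\ \theta_1,\dots,\theta_N\in\mathbb R\Big\},$$ $$\mathcal Y=\Big\{u\in H^2(D)\;\Big|\; u\in\mathcal X,\ \int_{\Gamma_i}\nabla u\cdot d\mathbf n=0\ \text{ for } i=1,\dots,N\Big\},$$ where $\int_{\Gamma_i}\nabla u\cdot d\mathbf n$ is the integral of $\nabla u\cdot\mathbf n$ over $\Gamma_i$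 with respect to arc length, with $\nabla u$ on $\Gamma_i$ in the sense of traces. Let $c\in L^\infty(D)$. If $$\int_D |\nabla u|^2+cu^2\,dx\ge 0\qquad\text{for all } u\in\mathcal Y,$$ then $$\int_D |\nabla u|^2+cu^2\,dx\ge 0\qquad\text{for all } u\in\mathcal X.$$ -/

import Mathlib

open MeasureTheory Filter Topology
open scoped ContDiff

noncomputable section

/-- The Euclidean plane. -/
abbrev Plane : Type := EuclideanSpace ℝ (Fin 2)

/-! ### Domains with smooth boundary -/

/-- Near the boundary point `x`, the set `Ω` is the sublevel set `{ρ < 0}` of a smooth function `ρ`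
without critical point at `x`. -/
def IsLocalDefiningFunction (Ω : Set Plane) (x : Plane) (ρ : Plane → ℝ) : Prop :=
  ContDiff ℝ ∞ ρ ∧ ρ x = 0 ∧ gradient ρ x ≠ 0 ∧ ∀ᶠ y in 𝓝 x, (y ∈ Ω ↔ ρ y < 0)

/-- A bounded simply connected domain of the plane with smooth boundary. -/
structure IsSmoothSimplyConnectedDomain (Ω : Set Plane) : Prop where
  isOpen : IsOpen Ω
  isBounded : Bornology.IsBounded Ω
  simplyConnected : SimplyConnectedSpace Ω
  smooth_boundary : ∀ x ∈ frontier Ω, ∃ ρ : Plane → ℝ, IsLocalDefiningFunction Ω x ρ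

/-- `Ω 0` is an outer domain, and `Ω 1, …, Ω N` are holes in it with disjoint closures. -/
structure IsHoleConfiguration {N : ℕ} (Ω : Fin (N + 1) → Set Plane) : Prop where
  smooth : ∀ i, IsSmoothSimplyConnectedDomain (Ω i)
  closure_subset : ∀ i : Fin N, closure (Ω i.succ) ⊆ Ω 0
  disjoint : ∀ i j : Fin N, i ≠ j → Disjoint (closure (Ω i.succ)) (closure (Ω j.succ))

/-- The outer domain with the closed holes removed. -/
def perforatedDomain {N : ℕ} (Ω : Fin (N + 1) → Set Plane) : Set Plane :=
  Ω 0 \ ⋃ i : Fin N, closure (Ω i.succ)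

open Classical in
/-- The outward unit normal of `D` at a smooth boundary point `x`: the normalized gradient of a
local defining function (it does not depend on which one); junk value `0` at other points. -/
def outerNormal (D : Set Plane) (x : Plane) : Plane :=
  if h : ∃ ρ : Plane → ℝ, IsLocalDefiningFunction D x ρ then
    ‖gradient h.choose x‖⁻¹ • gradient h.choose x
  else 0

/-! ### Sobolev spaces on `D`

Elements are represented by functions on the plane; all notions below depend only on the class
modulo equality almost everywhere on `D`. -/

/-- Test functions: smooth with compact support contained in `D`. -/
def IsTestFunction (D : Set Plane) (φ : Plane → ℝ) : Prop :=
  ContDiff ℝ ∞ φ ∧ HasCompactSupport φ ∧ tsupport φ ⊆ D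

/-- `u` lies in `L²(D)` and `G` is a square integrable weak gradient of `u` on `D`. -/
structure IsWeakGrad (D : Set Plane) (u : Plane → ℝ) (G : Plane → Plane) : Prop where
  memLp : MemLp u 2 (volume.restrict D)
  memLp_grad : MemLp G 2 (volume.restrict D)
  integral_eq : ∀ φ : Plane → ℝ, IsTestFunction D φ →
    ∫ x in D, u x • gradient φ x = -∫ x in D, φ x • G x

/-- `u ∈ H¹(D)`. -/
def MemH1 (D : Set Plane) (u : Plane → ℝ) : Prop := ∃ G : Plane → Plane, IsWeakGrad D u G

open Classical in
/-- The weak gradient of `u ∈ H¹(D)` (unique almost everywhere on an open set `D`). -/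
def weakGrad (D : Set Plane) (u : Plane → ℝ) : Plane → Plane :=
  if h : MemH1 D u then h.choose else 0

/-- `u ∈ H²(D)`. -/
def MemH2 (D : Set Plane) (u : Plane → ℝ) : Prop :=
  MemH1 D u ∧ ∀ k : Fin 2, MemH1 D (fun x => weakGrad D u x k)

/-- The smooth functions `φ n` converge to `u` in the norm of `H¹(D)`. -/
def TendstoH1 (D : Set Plane) (φ : ℕ → Plane → ℝ) (u : Plane → ℝ) : Prop :=
  Tendsto (fun n => eLpNorm (φ n - u) 2 (volume.restrict D)) atTop (𝓝 0) ∧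
  Tendsto (fun n => eLpNorm (gradient (φ n) - weakGrad D u) 2 (volume.restrict D)) atTop (𝓝 0)

/-- `v ∈ H¹₀(D)`, the closure of the test functions in `H¹(D)`. -/
def MemH10 (D : Set Plane) (v : Plane → ℝ) : Prop :=
  MemH1 D v ∧ ∃ φ : ℕ → Plane → ℝ, (∀ n, IsTestFunction D (φ n)) ∧ TendstoH1 D φ v

/-! ### Traces and boundary fluxes -/

/-- Arc length on a curve `Γ`. -/
def arcLength (Γ : Set Plane) : Measure Plane :=
  (Measure.hausdorffMeasure (X := Plane) 1).restrict Γ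

/-- `g ∈ L²(Γ)` is the trace of `f ∈ H¹(D)` on the part `Γ` of the boundary: `f` is the limit in
`H¹(D)` of functions that are smooth up to the boundary and whose restrictions to `Γ` tend to `g`
in `L²(Γ)`. -/
def HasTrace (D Γ : Set Plane) (f g : Plane → ℝ) : Prop :=
  MemH1 D f ∧ MemLp g 2 (arcLength Γ) ∧
  ∃ φ : ℕ → Plane → ℝ, (∀ n, ContDiff ℝ ∞ (φ n)) ∧ TendstoH1 D φ f ∧
    Tendsto (fun n => eLpNorm (φ n - g) 2 (arcLength Γ)) atTop (𝓝 0)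

/-- `∫_Γ ∇u · dn = a`, for `u ∈ H²(D)`, where `∇u` on `Γ` is understood in the sense of traces and
`n` is the unit normal pointing out of `D`. -/
def HasFlux (D Γ : Set Plane) (u : Plane → ℝ) (a : ℝ) : Prop :=
  ∃ g : Plane → Plane,
    (∀ k : Fin 2, HasTrace D Γ (fun x => weakGrad D u x k) (fun x => g x k)) ∧
    ∫ x, inner ℝ (g x) (outerNormal D x) ∂(arcLength Γ) = a

/-! ### The spaces `𝒳` and `𝒴` -/

/-- `ζ` is smooth up to the boundary, harmonic in the perforated domain, equal to `1` on the
boundary of the `i`-th hole and to `0` on all other boundary components. -/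
structure IsHoleHarmonic {N : ℕ} (Ω : Fin (N + 1) → Set Plane) (i : Fin N) (ζ : Plane → ℝ) :
    Prop where
  contDiff : ContDiff ℝ ∞ ζ
  harmonic : ∀ x ∈ perforatedDomain Ω, Laplacian.laplacian ζ x = 0
  boundary : ∀ j : Fin (N + 1), ∀ x ∈ frontier (Ω j), ζ x = if j = i.succ then 1 else 0

open Classical in
/-- The harmonic function `ζ_i` (extended smoothly to the plane; its values on the closure of the
perforated domain are uniquely determined). -/
def holeHarmonic {N : ℕ} (Ω : Fin (N + 1) → Set Plane) (i : Fin N) : Plane → ℝ :=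
  if h : ∃ ζ : Plane → ℝ, IsHoleHarmonic Ω i ζ then h.choose else 0

/-- The space `𝒳`. -/
def spaceX {N : ℕ} (Ω : Fin (N + 1) → Set Plane) : Set (Plane → ℝ) :=
  {u | MemH1 (perforatedDomain Ω) u ∧
    ∃ (v : Plane → ℝ) (θ : Fin N → ℝ), MemH10 (perforatedDomain Ω) v ∧
      u =ᵐ[volume.restrict (perforatedDomain Ω)]
        fun x => v x + ∑ i : Fin N, θ i * holeHarmonic Ω i x}

/-- The space `𝒴`. -/
def spaceY {N : ℕ} (Ω : Fin (N + 1) → Set Plane) : Set (Plane → ℝ) :=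
  {u | MemH2 (perforatedDomain Ω) u ∧ u ∈ spaceX Ω ∧
    ∀ i : Fin N, HasFlux (perforatedDomain Ω) (frontier (Ω i.succ)) u 0}

/-- The quadratic form `∫_D |∇u|² + c u² dx`. -/
def energy (D : Set Plane) (c u : Plane → ℝ) : ℝ :=
  ∫ x in D, (‖weakGrad D u x‖ ^ 2 + c x * u x ^ 2)

end

/-! ### Gradients of smooth functions -/

/-! Since `c` is bounded, the energy is continuous for the `H¹` norm (`tendsto_energy`), so it
suffices that `𝒴` is `H¹`-dense in `𝒳` (`IsHoleConfiguration.exists_tendstoH1_of_mem_spaceX`).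

The obstacle is the flux of the `ζ_i`, but modulo `H¹₀(D)` only their boundary values matter. Let
`χ_i` be a smooth cutoff, one near the `i`-th hole and zero near the other holes and near the
complement of the outer domain. Then `ζ_i - χ_i` vanishes on `∂D`, so it lies in `H¹₀(D)`, and `u =
(v + ∑ θ_i (ζ_i - χ_i)) + ∑ θ_i χ_i`. Approximating the bracket by test functions gives smooth
functions tending to `u` whose gradient vanishes on every `Γ_i`, `i ≥ 1`; their fluxes are zero.

The analytic core is `memH10_of_contDiff`: a smooth `w` vanishing on `∂D` lies in `H¹₀(D)`. It is
proved by truncating the values of `w` near zero, and it also shows that the approximants belong to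
`𝒳`. -/

theorem gradient_eq_toDual_symm (f : Plane → ℝ) (x : Plane) :
    gradient f x = (InnerProductSpace.toDual ℝ Plane).symm (fderiv ℝ f x) := rfl

theorem gradient_add_of_contDiff {f g : Plane → ℝ} (hf : ContDiff ℝ ∞ f) (hg : ContDiff ℝ ∞ g) :
    gradient (f + g) = gradient f + gradient g := by
  ext1 x
  simp only [Pi.add_apply, gradient_eq_toDual_symm]
  rw [fderiv_add (hf.differentiable (by simp) x) (hg.differentiable (by simp) x), map_add]

theorem gradient_sub_of_contDiff {f g : Plane → ℝ} (hf : ContDiff ℝ ∞ f) (hg : ContDiff ℝ ∞ g) :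
    gradient (f - g) = gradient f - gradient g := by
  ext1 x
  simp only [Pi.sub_apply, gradient_eq_toDual_symm]
  rw [fderiv_sub (hf.differentiable (by simp) x) (hg.differentiable (by simp) x), map_sub]

theorem contDiff_gradient {f : Plane → ℝ} (hf : ContDiff ℝ ∞ f) : ContDiff ℝ ∞ (gradient f) :=
  (InnerProductSpace.toDual ℝ Plane).symm.contDiff.comp (hf.fderiv_right (by simp))

theorem tsupport_gradient_subset (f : Plane → ℝ) : tsupport (gradient f) ⊆ tsupport f := by
  refine closure_minimal (fun x hx => ?_) (isClosed_tsupport f)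
  refine support_fderiv_subset ℝ (f := f) fun h => hx ?_
  simp [gradient_eq_toDual_symm, h]

/-- A smooth function has vanishing gradient almost everywhere on its zero set. -/
theorem ae_gradient_eq_zero_of_eq_zero {w : Plane → ℝ} (hw : ContDiff ℝ ∞ w) :
    ∀ᵐ x, w x = 0 → gradient w x = 0 := by
  -- The density-point estimate `norm_fderiv_sub_le` concerns maps of a space into itself, hence the
  -- detour through `w • e`. This map is zero on `s`, so the zero linear map approximates it there
  -- with constant `0`, which forces its derivative to vanish almost everywhere on `s`.
  set e : Plane := EuclideanSpace.single 0 1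
  have he : e ≠ 0 := by simp [e]
  set s : Set Plane := {x | w x = 0}
  have hs : MeasurableSet s := (isClosed_eq hw.continuous continuous_const).measurableSet
  have happrox : ApproximatesLinearOn (fun x => w x • e) (0 : Plane →L[ℝ] Plane) s 0 := by
    intro x hx y hy
    have hx : w x = 0 := hx
    have hy : w y = 0 := hy
    simp [hx, hy]
  have hderiv : ∀ x ∈ s, HasFDerivWithinAt (fun x => w x • e) ((fderiv ℝ w x).smulRight e) s x :=
    fun x _ => ((hw.differentiable (by simp) x).hasFDerivAt.smul_const e).hasFDerivWithinAt
  have h := happrox.norm_fderiv_sub_le volume hs _ hderiv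
  rw [ae_restrict_iff' hs] at h
  filter_upwards [h] with x hx hwx
  have hx := hx hwx
  rw [sub_zero, nonpos_iff_eq_zero, nnnorm_eq_zero] at hx
  have h0 : fderiv ℝ w x = 0 := by
    ext1 y
    have := DFunLike.congr_fun hx y
    simpa [he] using this
  simp [gradient_eq_toDual_symm, h0]

/-! ### Square integrability on bounded sets -/

theorem isFiniteMeasure_restrict_of_isBounded {D : Set Plane} (hD : Bornology.IsBounded D) :
    IsFiniteMeasure (volume.restrict D) :=
  ⟨by simpa using hD.measure_lt_top⟩

theorem exists_norm_le_of_continuous {E : Type*} [NormedAddCommGroup E] {D : Set Plane}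
    (hD : Bornology.IsBounded D) {f : Plane → E} (hf : Continuous f) : ∃ C, ∀ x ∈ D, ‖f x‖ ≤ C := by
  obtain ⟨C, hC⟩ := hD.isCompact_closure.exists_bound_of_continuousOn hf.continuousOn
  exact ⟨C, fun x hx => hC x (subset_closure hx)⟩

theorem memLp_restrict_of_continuous {E : Type*} [NormedAddCommGroup E]
    [SecondCountableTopologyEither Plane E] {D : Set Plane} (hDo : IsOpen D)
    (hD : Bornology.IsBounded D) {f : Plane → E} (hf : Continuous f) (p : ENNReal) :
    MemLp f p (volume.restrict D) := by
  have := isFiniteMeasure_restrict_of_isBounded hD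
  obtain ⟨C, hC⟩ := exists_norm_le_of_continuous hD hf
  refine MemLp.of_bound hf.aestronglyMeasurable C ?_
  filter_upwards [ae_restrict_mem hDo.measurableSet] with x hx using hC x hx

/-- Dominated convergence to zero in `L²`, for uniformly bounded functions on a space of finite
measure. -/
theorem tendsto_eLpNorm_two_zero_of_bounded {α E : Type*} [MeasurableSpace α] {μ : Measure α}
    [IsFiniteMeasure μ] [NormedAddCommGroup E] {f : ℕ → α → E}
    (hf : ∀ n, AEStronglyMeasurable (f n) μ) {C : ℝ} (hC : ∀ n, ∀ᵐ x ∂μ, ‖f n x‖ ≤ C)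
    (hlim : ∀ᵐ x ∂μ, Tendsto (fun n => f n x) atTop (𝓝 0)) :
    Tendsto (fun n => eLpNorm (f n) 2 μ) atTop (𝓝 0) := by
  simp_rw [eLpNorm_eq_lintegral_rpow_enorm_toReal two_ne_zero ENNReal.ofNat_ne_top]
  have h : Tendsto (fun n => ∫⁻ x, ‖f n x‖ₑ ^ (2 : ENNReal).toReal ∂μ) atTop
      (𝓝 (∫⁻ _, 0 ∂μ)) := by
    refine tendsto_lintegral_of_dominated_convergence'
      (fun _ => ENNReal.ofReal C ^ (2 : ENNReal).toReal) (fun n => (hf n).enorm.pow_const _)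
      (fun n => ?_) ?_ ?_
    · filter_upwards [hC n] with x hx
      refine ENNReal.rpow_le_rpow ?_ (by simp)
      rw [← ofReal_norm]
      exact ENNReal.ofReal_le_ofReal hx
    · rw [lintegral_const]
      exact ENNReal.mul_ne_top (by simp) (measure_ne_top _ _)
    · filter_upwards [hlim] with x hx
      have := ((continuous_enorm.tendsto (0 : E)).comp hx).ennrpow_const (2 : ENNReal).toReal
      simpa using this
  simpa using h.ennrpow_const (1 / (2 : ENNReal).toReal)

/-- Joint continuity of the inner product of the Hilbert space `L²`, transported to representatives.
-/
theorem tendsto_integral_inner_of_tendsto_eLpNorm {α E : Type*} [MeasurableSpace α] {μ : Measure α}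
    [NormedAddCommGroup E] [InnerProductSpace ℝ E] {f g : ℕ → α → E} {f₀ g₀ : α → E}
    (hf : ∀ n, MemLp (f n) 2 μ) (hg : ∀ n, MemLp (g n) 2 μ) (hf₀ : MemLp f₀ 2 μ)
    (hg₀ : MemLp g₀ 2 μ) (hlimf : Tendsto (fun n => eLpNorm (f n - f₀) 2 μ) atTop (𝓝 0))
    (hlimg : Tendsto (fun n => eLpNorm (g n - g₀) 2 μ) atTop (𝓝 0)) :
    Tendsto (fun n => ∫ x, inner ℝ (f n x) (g n x) ∂μ) atTop (𝓝 (∫ x, inner ℝ (f₀ x) (g₀ x) ∂μ)) := by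
  have key : ∀ {a b : α → E} (ha : MemLp a 2 μ) (hb : MemLp b 2 μ),
      inner ℝ (ha.toLp a) (hb.toLp b) = ∫ x, inner ℝ (a x) (b x) ∂μ := by
    intro a b ha hb
    rw [L2.inner_def]
    refine integral_congr_ae ?_
    filter_upwards [ha.coeFn_toLp, hb.coeFn_toLp] with x h1 h2
    rw [h1, h2]
  have h := Filter.Tendsto.inner (𝕜 := ℝ)
    ((Lp.tendsto_Lp_iff_tendsto_eLpNorm'' f hf f₀ hf₀).2 hlimf)
    ((Lp.tendsto_Lp_iff_tendsto_eLpNorm'' g hg g₀ hg₀).2 hlimg)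
  simpa only [key] using h

theorem memLp_integrable_inner {α E : Type*} [MeasurableSpace α] {μ : Measure α}
    [NormedAddCommGroup E] [InnerProductSpace ℝ E] {f g : α → E}
    (hf : MemLp f 2 μ) (hg : MemLp g 2 μ) : Integrable (fun x => inner ℝ (f x) (g x)) μ := by
  refine (L2.integrable_inner (𝕜 := ℝ) (hf.toLp f) (hg.toLp g)).congr ?_
  filter_upwards [hf.coeFn_toLp, hg.coeFn_toLp] with x h1 h2
  rw [h1, h2]

/-! ### Weak gradients -/

theorem integral_smul_gradient_eq_neg {u φ : Plane → ℝ} (hu : ContDiff ℝ ∞ u)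
    (hφ : ContDiff ℝ ∞ φ) (hc : HasCompactSupport φ) :
    ∫ x, u x • gradient φ x = -∫ x, φ x • gradient u x := by
  have hcg : HasCompactSupport (gradient φ) :=
    hc.of_isClosed_subset (isClosed_tsupport _) (tsupport_gradient_subset φ)
  have hgu := (contDiff_gradient hu).continuous
  have hgφ := (contDiff_gradient hφ).continuous
  have i1 : Integrable (fun x => u x • gradient φ x) :=
    (hu.continuous.smul hgφ).integrable_of_hasCompactSupport hcg.smul_left
  have i2 : Integrable (fun x => φ x • gradient u x) :=
    (hφ.continuous.smul hgu).integrable_of_hasCompactSupport hc.smul_right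
  -- Pairing with a fixed vector `v` reduces the claim to scalar integration by parts in the
  -- direction `v`.
  refine ext_inner_left ℝ fun v => ?_
  rw [inner_neg_right, ← integral_inner i1, ← integral_inner i2]
  have hd : ∀ (f : Plane → ℝ) (x : Plane), inner ℝ v (gradient f x) = fderiv ℝ f x v := by
    intro f x
    rw [real_inner_comm, inner_gradient_left]
  have j1 := i1.const_inner (𝕜 := ℝ) v
  have j2 := i2.const_inner (𝕜 := ℝ) v
  simp only [inner_smul_right, hd] at j1 j2 ⊢
  have h := integral_mul_fderiv_eq_neg_fderiv_mul_of_integrable (μ := volume) (f := u) (g := φ)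
    (v := v) (by simpa only [mul_comm] using j2) j1
    ((hu.continuous.mul hφ.continuous).integrable_of_hasCompactSupport hc.mul_left)
    (fun x _ => hu.differentiable (by simp) x) (fun x _ => hφ.differentiable (by simp) x)
  simpa only [mul_comm] using h

theorem isWeakGrad_gradient {D : Set Plane} (hDo : IsOpen D) (hD : Bornology.IsBounded D)
    {u : Plane → ℝ} (hu : ContDiff ℝ ∞ u) : IsWeakGrad D u (gradient u) where
  memLp := memLp_restrict_of_continuous hDo hD hu.continuous 2
  memLp_grad := memLp_restrict_of_continuous hDo hD (contDiff_gradient hu).continuous 2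
  integral_eq φ hφ := by
    obtain ⟨h1, h2, h3⟩ := hφ
    rw [setIntegral_eq_integral_of_forall_compl_eq_zero,
      setIntegral_eq_integral_of_forall_compl_eq_zero]
    · exact integral_smul_gradient_eq_neg hu h1 h2
    · intro x hx
      rw [image_eq_zero_of_notMem_tsupport fun h => hx (h3 h), zero_smul]
    · intro x hx
      rw [image_eq_zero_of_notMem_tsupport fun h => hx (h3 (tsupport_gradient_subset φ h)),
        smul_zero]

theorem IsTestFunction.memLp_two {D : Set Plane} {φ : Plane → ℝ} (hφ : IsTestFunction D φ) :
    MemLp φ 2 (volume.restrict D) ∧ MemLp (gradient φ) 2 (volume.restrict D) := by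
  obtain ⟨h1, h2, -⟩ := hφ
  have hcg : HasCompactSupport (gradient φ) :=
    h2.of_isClosed_subset (isClosed_tsupport _) (tsupport_gradient_subset φ)
  exact ⟨(h1.continuous.memLp_of_hasCompactSupport h2).restrict D,
    ((contDiff_gradient h1).continuous.memLp_of_hasCompactSupport hcg).restrict D⟩

theorem MeasureTheory.MemLp.integrable_smul_two {α E : Type*} [MeasurableSpace α] {μ : Measure α}
    [NormedAddCommGroup E] [NormedSpace ℝ E] {f : α → ℝ} {g : α → E}
    (hf : MemLp f 2 μ) (hg : MemLp g 2 μ) : Integrable (fun x => f x • g x) μ :=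
  memLp_one_iff_integrable.1 (hg.smul hf)

theorem IsWeakGrad.congr {D : Set Plane} {u u' : Plane → ℝ} {G G' : Plane → Plane}
    (h : IsWeakGrad D u G) (hu : u =ᵐ[volume.restrict D] u')
    (hG : G =ᵐ[volume.restrict D] G') : IsWeakGrad D u' G' where
  memLp := h.memLp.ae_eq hu
  memLp_grad := h.memLp_grad.ae_eq hG
  integral_eq φ hφ := by
    rw [← integral_congr_ae (hu.mono fun x hx => show u x • gradient φ x = u' x • _ by rw [hx]),
      ← integral_congr_ae (hG.mono fun x hx => show φ x • G x = _ • G' x by rw [hx])]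
    exact h.integral_eq φ hφ

theorem IsWeakGrad.add {D : Set Plane} {u v : Plane → ℝ} {G H : Plane → Plane}
    (hu : IsWeakGrad D u G) (hv : IsWeakGrad D v H) : IsWeakGrad D (u + v) (G + H) where
  memLp := hu.memLp.add hv.memLp
  memLp_grad := hu.memLp_grad.add hv.memLp_grad
  integral_eq φ hφ := by
    have h1 := hφ.memLp_two.1
    have h2 := hφ.memLp_two.2
    simp only [Pi.add_apply, add_smul, smul_add]
    rw [integral_add (hu.memLp.integrable_smul_two h2) (hv.memLp.integrable_smul_two h2),
      integral_add (h1.integrable_smul_two hu.memLp_grad) (h1.integrable_smul_two hv.memLp_grad),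
      hu.integral_eq φ hφ, hv.integral_eq φ hφ, neg_add]

/-- The fundamental lemma of the calculus of variations: `G - H` is orthogonal to all test
functions. -/
theorem IsWeakGrad.unique {D : Set Plane} (hDo : IsOpen D) {u : Plane → ℝ} {G H : Plane → Plane}
    (hG : IsWeakGrad D u G) (hH : IsWeakGrad D u H) : G =ᵐ[volume.restrict D] H := by
  have hGH : MemLp (G - H) 2 (volume.restrict D) := hG.memLp_grad.sub hH.memLp_grad
  have hloc : LocallyIntegrableOn (G - H) D volume := by
    refine (locallyIntegrableOn_of_locallyIntegrable_restrict ?_)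
    exact hGH.locallyIntegrable (by norm_num)
  have h := hDo.ae_eq_zero_of_integral_contDiff_smul_eq_zero hloc fun φ h1 h2 h3 => by
    have hφ : IsTestFunction D φ := ⟨h1, h2, h3⟩
    have hm := hφ.memLp_two.1
    rw [← setIntegral_eq_integral_of_forall_compl_eq_zero (s := D)]
    · simp only [Pi.sub_apply, smul_sub]
      rw [integral_sub (hm.integrable_smul_two hG.memLp_grad)
        (hm.integrable_smul_two hH.memLp_grad), sub_eq_zero, ← neg_inj, ← hG.integral_eq φ hφ,
        hH.integral_eq φ hφ]
    · intro x hx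
      rw [image_eq_zero_of_notMem_tsupport fun h => hx (h3 h), zero_smul]
  rw [EventuallyEq, ae_restrict_iff' hDo.measurableSet]
  filter_upwards [h] with x hx hxD using sub_eq_zero.1 (hx hxD)

theorem MemH1.isWeakGrad {D : Set Plane} {u : Plane → ℝ} (h : MemH1 D u) :
    IsWeakGrad D u (weakGrad D u) := by
  unfold weakGrad
  rw [dif_pos h]
  exact h.choose_spec

theorem IsWeakGrad.weakGrad_ae_eq {D : Set Plane} (hDo : IsOpen D) {u : Plane → ℝ}
    {G : Plane → Plane} (h : IsWeakGrad D u G) : weakGrad D u =ᵐ[volume.restrict D] G :=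
  MemH1.isWeakGrad ⟨G, h⟩ |>.unique hDo h

/-- `weakGrad` is an arbitrary choice; by uniqueness, convergence may be tested against any explicit
weak gradient. -/
theorem tendstoH1_of_isWeakGrad {D : Set Plane} (hDo : IsOpen D) {φ : ℕ → Plane → ℝ}
    {u : Plane → ℝ} {G : Plane → Plane} (hG : IsWeakGrad D u G)
    (h1 : Tendsto (fun n => eLpNorm (φ n - u) 2 (volume.restrict D)) atTop (𝓝 0))
    (h2 : Tendsto (fun n => eLpNorm (gradient (φ n) - G) 2 (volume.restrict D)) atTop (𝓝 0)) :
    TendstoH1 D φ u := by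
  refine ⟨h1, h2.congr fun n => eLpNorm_congr_ae ?_⟩
  exact EventuallyEq.rfl.sub (hG.weakGrad_ae_eq hDo).symm

theorem tendstoH1_const {D : Set Plane} (hDo : IsOpen D) (hD : Bornology.IsBounded D)
    {f u : Plane → ℝ} (hf : ContDiff ℝ ∞ f) (hfu : f =ᵐ[volume.restrict D] u) :
    TendstoH1 D (fun _ => f) u := by
  refine tendstoH1_of_isWeakGrad hDo
    ((isWeakGrad_gradient hDo hD hf).congr hfu EventuallyEq.rfl) ?_ ?_
  · have : eLpNorm (f - u) 2 (volume.restrict D) = 0 := by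
      rw [eLpNorm_congr_ae (hfu.sub (EventuallyEq.refl _ u)), sub_self, eLpNorm_zero]
    simp [this]
  · simp

theorem TendstoH1.add {D : Set Plane} (hDo : IsOpen D) {φ ψ : ℕ → Plane → ℝ} {u v : Plane → ℝ}
    (hφ : ∀ n, ContDiff ℝ ∞ (φ n)) (hψ : ∀ n, ContDiff ℝ ∞ (ψ n)) (hu : MemH1 D u)
    (hv : MemH1 D v) (h : TendstoH1 D φ u) (h' : TendstoH1 D ψ v) :
    TendstoH1 D (fun n => φ n + ψ n) (u + v) := by
  have hgu := hu.isWeakGrad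
  have hgv := hv.isWeakGrad
  have key : ∀ {E : Type} [NormedAddCommGroup E] {f g : ℕ → Plane → E} {f₀ g₀ : Plane → E},
      (∀ n, AEStronglyMeasurable (f n - f₀) (volume.restrict D)) →
      (∀ n, AEStronglyMeasurable (g n - g₀) (volume.restrict D)) →
      Tendsto (fun n => eLpNorm (f n - f₀) 2 (volume.restrict D)) atTop (𝓝 0) →
      Tendsto (fun n => eLpNorm (g n - g₀) 2 (volume.restrict D)) atTop (𝓝 0) →
      Tendsto (fun n => eLpNorm (f n + g n - (f₀ + g₀)) 2 (volume.restrict D)) atTop (𝓝 0) := by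
    intro E _ f g f₀ g₀ hf hg h1 h2
    refine tendsto_of_tendsto_of_tendsto_of_le_of_le tendsto_const_nhds
      (by simpa using h1.add h2) (fun _ => zero_le) fun n => ?_
    simp only [add_sub_add_comm]
    exact eLpNorm_add_le (hf n) (hg n) (by norm_num)
  refine tendstoH1_of_isWeakGrad hDo (hgu.add hgv) ?_ ?_
  · exact key (fun n => (hφ n).continuous.aestronglyMeasurable.sub hgu.memLp.1)
      (fun n => (hψ n).continuous.aestronglyMeasurable.sub hgv.memLp.1) h.1 h'.1
  · simp only [gradient_add_of_contDiff (hφ _) (hψ _)]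
    exact key (fun n => (contDiff_gradient (hφ n)).continuous.aestronglyMeasurable.sub
        hgu.memLp_grad.1)
      (fun n => (contDiff_gradient (hψ n)).continuous.aestronglyMeasurable.sub
        hgv.memLp_grad.1) h.2 h'.2

theorem TendstoH1.congr_limit {D : Set Plane} (hDo : IsOpen D) {φ : ℕ → Plane → ℝ}
    {u v : Plane → ℝ} (hu : MemH1 D u) (h : TendstoH1 D φ u) (huv : u =ᵐ[volume.restrict D] v) :
    TendstoH1 D φ v := by
  refine tendstoH1_of_isWeakGrad hDo (hu.isWeakGrad.congr huv EventuallyEq.rfl) ?_ h.2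
  exact h.1.congr fun n => eLpNorm_congr_ae (EventuallyEq.rfl.sub huv)

/-! ### Truncation -/

/-- A smooth compactly supported modification of the identity function of the real line. -/
theorem exists_contDiff_hasCompactSupport_eq_id :
    ∃ h : ℝ → ℝ, ContDiff ℝ ∞ h ∧ HasCompactSupport h ∧ ∀ t, |t| ≤ 1 → h t = t := by
  let β : ContDiffBump (0 : ℝ) := ⟨1, 2, one_pos, one_lt_two⟩
  refine ⟨fun t => t * β t, contDiff_id.mul β.contDiff, β.hasCompactSupport.mul_left,
    fun t ht => ?_⟩
  change t * β t = t
  rw [β.one_of_mem_closedBall (by simpa [β] using ht), mul_one]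

theorem gradient_comp_of_contDiff {h : ℝ → ℝ} {w : Plane → ℝ} (hh : ContDiff ℝ ∞ h)
    (hw : ContDiff ℝ ∞ w) (x : Plane) :
    gradient (fun y => h (w y)) x = deriv h (w x) • gradient w x := by
  have h1 := (hh.differentiable (by simp) (w x)).hasDerivAt.comp_hasFDerivAt x
    (hw.differentiable (by simp) x).hasFDerivAt
  rw [gradient_eq_toDual_symm, gradient_eq_toDual_symm, ← map_smul]
  exact congrArg _ h1.fderiv

/-- If `w` is smooth and vanishes on the boundary of the bounded open set `D`, and `q` is a smooth
function of a real variable that is the identity near zero, then `w - q ∘ w`, cut off outside `D`,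
is a test function. -/
theorem isTestFunction_indicator_sub_comp {D : Set Plane} (hDo : IsOpen D)
    (hD : Bornology.IsBounded D) {w : Plane → ℝ} (hw : ContDiff ℝ ∞ w)
    (hw0 : ∀ x ∈ frontier D, w x = 0) {q : ℝ → ℝ} (hq : ContDiff ℝ ∞ q) {δ : ℝ} (hδ : 0 < δ)
    (hqδ : ∀ t, |t| < δ → q t = t) :
    IsTestFunction D (D.indicator fun x => w x - q (w x)) := by
  set ψ : Plane → ℝ := D.indicator fun x => w x - q (w x)
  -- `w - q ∘ w` vanishes where `|w| < δ`, so its cutoff is supported in `K`; and `K` misses the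
  -- boundary because `w` is zero there.
  set K : Set Plane := closure D ∩ {x | δ ≤ |w x|}
  have hKc : IsClosed K := isClosed_closure.inter (isClosed_le continuous_const hw.continuous.abs)
  have hKD : K ⊆ D := by
    rintro x ⟨hx, hxw⟩
    by_contra hxD
    have hxf : x ∈ frontier D := ⟨hx, by rwa [hDo.interior_eq]⟩
    have hxw : δ ≤ |w x| := hxw
    rw [hw0 x hxf, abs_zero] at hxw
    exact absurd hxw (not_le.2 hδ)
  have hψK : ∀ x ∉ K, ψ x = 0 := by
    intro x hx
    by_cases hxD : x ∈ D
    · have hlt : |w x| < δ := not_le.1 fun h => hx ⟨subset_closure hxD, h⟩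
      simp [ψ, hxD, hqδ _ hlt]
    · simp [ψ, hxD]
  have hsupp : tsupport ψ ⊆ K :=
    closure_minimal (fun x hx => by_contra fun h => hx (hψK x h)) hKc
  have hK : IsCompact K := hD.isCompact_closure.inter_right
    (isClosed_le continuous_const hw.continuous.abs)
  refine ⟨contDiff_iff_contDiffAt.2 fun x => ?_, hK.of_isClosed_subset (isClosed_tsupport _) hsupp,
    hsupp.trans hKD⟩
  by_cases hxK : x ∈ K
  · refine (hw.sub (hq.comp hw)).contDiffAt.congr_of_eventuallyEq ?_
    filter_upwards [hDo.mem_nhds (hKD hxK)] with y hy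
    simp [ψ, hy]
  · refine (contDiff_const (c := (0 : ℝ))).contDiffAt.congr_of_eventuallyEq ?_
    filter_upwards [hKc.isOpen_compl.mem_nhds hxK] with y hy using hψK y hy

/-- A smooth function vanishing on the boundary of a bounded open set `D` belongs to `H¹₀(D)`. -/
theorem memH10_of_contDiff {D : Set Plane} (hDo : IsOpen D) (hD : Bornology.IsBounded D)
    {w : Plane → ℝ} (hw : ContDiff ℝ ∞ w) (hw0 : ∀ x ∈ frontier D, w x = 0) : MemH10 D w := by
  have := isFiniteMeasure_restrict_of_isBounded hD
  have hwg := isWeakGrad_gradient hDo hD hw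
  obtain ⟨h, hh, hhc, hhid⟩ := exists_contDiff_hasCompactSupport_eq_id
  -- The shift by one gives `a n ≥ 1`, so that `C` bounds every `q n`.
  set a : ℕ → ℝ := fun n => (n : ℝ) + 1
  have ha : ∀ n, 0 < a n := fun n => by positivity
  have ha1 : ∀ n, 1 ≤ a n := fun n => by simp [a]
  have ha_top : Tendsto a atTop atTop :=
    tendsto_atTop_add_const_right _ _ tendsto_natCast_atTop_atTop
  -- Rescaling keeps `q n` the identity near zero and makes it uniformly small, while its derivative
  -- stays bounded and is eventually zero at each `t ≠ 0`.
  set q : ℕ → ℝ → ℝ := fun n t => h (a n * t) / a n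
  have hq : ∀ n, ContDiff ℝ ∞ (q n) := fun n =>
    (hh.comp (contDiff_const.mul contDiff_id)).div_const _
  have hqd : ∀ n t, deriv (q n) t = deriv h (a n * t) := by
    intro n t
    have h1 : HasDerivAt (fun t => a n * t) (a n) t := by
      simpa using (hasDerivAt_id t).const_mul (a n)
    have h2 : HasDerivAt (fun t => h (a n * t) / a n) (deriv h (a n * t) * a n / a n) t :=
      ((hh.differentiable (by simp) (a n * t)).hasDerivAt.comp t h1).div_const _
    rw [mul_div_cancel_right₀ _ (ha n).ne'] at h2
    exact h2.deriv
  have hqid : ∀ n t, |t| < 1 / a n → q n t = t := by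
    intro n t ht
    rw [lt_div_iff₀ (ha n)] at ht
    have : |a n * t| ≤ 1 := by
      rw [abs_mul, abs_of_pos (ha n), mul_comm]
      exact ht.le
    simp only [q]
    rw [hhid _ this, mul_div_cancel_left₀ _ (ha n).ne']
  obtain ⟨C, hC⟩ := hhc.exists_bound_of_continuous hh.continuous
  have hdc : HasCompactSupport (deriv h) := hhc.deriv
  obtain ⟨C', hC'⟩ := hdc.exists_bound_of_continuous (hh.continuous_deriv (by simp))
  obtain ⟨B, hB⟩ := exists_norm_le_of_continuous hD (contDiff_gradient hw).continuous
  have hC'0 : 0 ≤ C' := (norm_nonneg _).trans (hC' 0)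
  set ψ : ℕ → Plane → ℝ := fun n => D.indicator fun x => w x - q n (w x)
  have hψ : ∀ n, IsTestFunction D (ψ n) := fun n =>
    isTestFunction_indicator_sub_comp hDo hD hw hw0 (hq n) (one_div_pos.2 (ha n)) (hqid n)
  have hdiff : ∀ n, ∀ x ∈ D, (ψ n - w) x = -q n (w x) := by
    intro n x hx
    simp [ψ, hx]
  have hgdiff : ∀ n, ∀ x ∈ D, (gradient (ψ n) - gradient w) x =
      -(deriv h (a n * w x) • gradient w x) := by
    intro n x hx
    have h1 : ψ n =ᶠ[𝓝 x] w - fun y => q n (w y) := by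
      filter_upwards [hDo.mem_nhds hx] with y hy
      simp [ψ, hy]
    rw [Pi.sub_apply, h1.gradient_eq,
      gradient_sub_of_contDiff (g := fun y => q n (w y)) hw ((hq n).comp hw), Pi.sub_apply,
      gradient_comp_of_contDiff (hq n) hw, hqd]
    abel
  refine ⟨⟨_, hwg⟩, ψ, hψ, tendstoH1_of_isWeakGrad hDo hwg ?_ ?_⟩
  · refine tendsto_eLpNorm_two_zero_of_bounded (C := C)
      (fun n => ((hψ n).1.continuous.sub hw.continuous).aestronglyMeasurable) (fun n => ?_) ?_
    · filter_upwards [ae_restrict_mem hDo.measurableSet] with x hx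
      rw [hdiff n x hx, norm_neg, norm_div, Real.norm_of_nonneg (ha n).le]
      exact (div_le_self (norm_nonneg _) (ha1 n)).trans (hC _)
    · filter_upwards [ae_restrict_mem hDo.measurableSet] with x hx
      simp only [hdiff _ x hx]
      rw [← neg_zero]
      refine (squeeze_zero_norm (a := fun n => C / a n) (fun n => ?_)
        (tendsto_const_nhds.div_atTop ha_top)).neg
      rw [norm_div, Real.norm_of_nonneg (ha n).le]
      exact div_le_div_of_nonneg_right (hC _) (ha n).le
  · refine tendsto_eLpNorm_two_zero_of_bounded (C := C' * B)
      (fun n => ((contDiff_gradient (hψ n).1).continuous.sub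
        (contDiff_gradient hw).continuous).aestronglyMeasurable) (fun n => ?_) ?_
    · filter_upwards [ae_restrict_mem hDo.measurableSet] with x hx
      rw [hgdiff n x hx, norm_neg, norm_smul]
      exact mul_le_mul (hC' _) (hB x hx) (norm_nonneg _) hC'0
    · filter_upwards [ae_restrict_mem hDo.measurableSet,
        ae_restrict_of_ae (ae_gradient_eq_zero_of_eq_zero hw)] with x hx hx0
      simp only [hgdiff _ x hx]
      -- On the zero set the factor `deriv h (a n * w x)` does not decay, and only the almost
      -- everywhere vanishing of the gradient helps. Elsewhere `a n * w x` leaves the support of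
      -- `deriv h`.
      by_cases hwx : w x = 0
      · simp [hx0 hwx]
      · obtain ⟨R, hR⟩ := hdc.isCompact.isBounded.exists_norm_le
        have hlarge : ∀ᶠ n in atTop, R < a n * |w x| :=
          (ha_top.atTop_mul_const (abs_pos.2 hwx)).eventually_gt_atTop R
        refine tendsto_const_nhds.congr' ?_
        filter_upwards [hlarge] with n hn
        have : a n * w x ∉ tsupport (deriv h) := by
          intro hmem
          have := hR _ hmem
          rw [Real.norm_eq_abs, abs_mul, abs_of_pos (ha n)] at this
          exact absurd hn (not_lt.2 this)
        rw [image_eq_zero_of_notMem_tsupport this, zero_smul, neg_zero]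

theorem IsTestFunction.gradient_eq_zero_of_notMem {D : Set Plane} {φ : Plane → ℝ}
    (hφ : IsTestFunction D φ) {x : Plane} (hx : x ∉ D) : gradient φ x = 0 :=
  image_eq_zero_of_notMem_tsupport fun h => hx (hφ.2.2 (tsupport_gradient_subset φ h))

theorem IsTestFunction.eq_zero_of_mem_frontier {D : Set Plane} (hDo : IsOpen D) {φ : Plane → ℝ}
    (hφ : IsTestFunction D φ) {x : Plane} (hx : x ∈ frontier D) : φ x = 0 :=
  image_eq_zero_of_notMem_tsupport fun h => (hDo.frontier_eq ▸ hx).2 (hφ.2.2 h)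

/-! ### Continuity of the energy -/

/-- The energy is the sum of the `L²` inner products of the gradient with itself and of `u` with `c
u`, and multiplication by the bounded `c` is continuous on `L²`. -/
theorem tendsto_energy {D : Set Plane} {c : Plane → ℝ} (hc : MemLp c ⊤ (volume.restrict D))
    {f : ℕ → Plane → ℝ} {u : Plane → ℝ} (hf : ∀ n, MemH1 D (f n)) (hu : MemH1 D u)
    (h1 : Tendsto (fun n => eLpNorm (f n - u) 2 (volume.restrict D)) atTop (𝓝 0))
    (h2 : Tendsto (fun n => eLpNorm (weakGrad D (f n) - weakGrad D u) 2 (volume.restrict D))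
      atTop (𝓝 0)) :
    Tendsto (fun n => energy D c (f n)) atTop (𝓝 (energy D c u)) := by
  have hcm : ∀ {v : Plane → ℝ}, MemLp v 2 (volume.restrict D) →
      MemLp (c • v) 2 (volume.restrict D) := fun hv => hv.smul hc
  have henergy : ∀ v, MemH1 D v → energy D c v =
      (∫ x in D, inner ℝ (weakGrad D v x) (weakGrad D v x)) +
        ∫ x in D, inner ℝ (v x) ((c • v) x) := by
    intro v hv
    have hg := hv.isWeakGrad
    rw [← integral_add (memLp_integrable_inner hg.memLp_grad hg.memLp_grad)
      (memLp_integrable_inner hg.memLp (hcm hg.memLp)), energy]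
    refine integral_congr_ae (Eventually.of_forall fun x => ?_)
    simp only [real_inner_self_eq_norm_sq, Pi.smul_apply', smul_eq_mul, RCLike.inner_apply,
      conj_trivial]
    ring
  rw [henergy u hu]
  simp only [fun n => henergy (f n) (hf n)]
  refine (tendsto_integral_inner_of_tendsto_eLpNorm (fun n => (hf n).isWeakGrad.memLp_grad)
    (fun n => (hf n).isWeakGrad.memLp_grad) hu.isWeakGrad.memLp_grad hu.isWeakGrad.memLp_grad
    h2 h2).add (tendsto_integral_inner_of_tendsto_eLpNorm (fun n => (hf n).isWeakGrad.memLp)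
    (fun n => hcm (hf n).isWeakGrad.memLp) hu.isWeakGrad.memLp (hcm hu.isWeakGrad.memLp) h1 ?_)
  refine tendsto_of_tendsto_of_tendsto_of_le_of_le tendsto_const_nhds ?_ (fun _ => zero_le)
    (fun n => ?_) (h := fun n =>
      eLpNorm c ⊤ (volume.restrict D) * eLpNorm (f n - u) 2 (volume.restrict D))
  · simpa using ENNReal.Tendsto.const_mul h1 (Or.inr hc.eLpNorm_ne_top)
  · simp only [← smul_sub]
    exact eLpNorm_smul_le_eLpNorm_top_mul_eLpNorm 2
      ((hf n).isWeakGrad.memLp.sub hu.isWeakGrad.memLp).1 c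

/-! ### Perforated domains -/

section Perforated

variable {N : ℕ} {Ω : Fin (N + 1) → Set Plane}

theorem IsHoleConfiguration.isOpen_perforatedDomain (hΩ : IsHoleConfiguration Ω) :
    IsOpen (perforatedDomain Ω) :=
  (hΩ.smooth 0).isOpen.sdiff (isClosed_iUnion_of_finite fun _ => isClosed_closure)

theorem IsHoleConfiguration.isBounded_perforatedDomain (hΩ : IsHoleConfiguration Ω) :
    Bornology.IsBounded (perforatedDomain Ω) :=
  (hΩ.smooth 0).isBounded.subset Set.sdiff_subset

/-- Off all the frontiers, membership in `Ω 0` and in each closed hole is locally constant, hence so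
is membership in the perforated domain. -/
theorem exists_mem_frontier_of_mem_frontier_perforatedDomain {x : Plane}
    (hx : x ∈ frontier (perforatedDomain Ω)) : ∃ j, x ∈ frontier (Ω j) := by
  have hc : IsClosed (⋃ i : Fin N, closure (Ω i.succ)) :=
    isClosed_iUnion_of_finite fun _ => isClosed_closure
  by_contra! hcon
  have h0 : ∀ᶠ y in 𝓝 x, y ∈ Ω 0 ↔ x ∈ Ω 0 := by
    by_cases h : x ∈ Ω 0
    · have : x ∈ interior (Ω 0) := by_contra fun h' => hcon 0 ⟨subset_closure h, h'⟩
      filter_upwards [mem_interior_iff_mem_nhds.1 this] with y hy using ⟨fun _ => h, fun _ => hy⟩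
    · have : x ∉ closure (Ω 0) := fun h' => hcon 0 ⟨h', fun h'' => h (interior_subset h'')⟩
      filter_upwards [isClosed_closure.isOpen_compl.mem_nhds this] with y hy
      exact ⟨fun hy' => absurd (subset_closure hy') hy, fun h' => absurd h' h⟩
  have h1 : ∀ i : Fin N, ∀ᶠ y in 𝓝 x, y ∈ closure (Ω i.succ) ↔ x ∈ closure (Ω i.succ) := by
    intro i
    by_cases h : x ∈ closure (Ω i.succ)
    · have : x ∈ interior (Ω i.succ) := by_contra fun h' => hcon i.succ ⟨h, h'⟩
      filter_upwards [mem_interior_iff_mem_nhds.1 this] with y hy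
      exact ⟨fun _ => h, fun _ => subset_closure hy⟩
    · filter_upwards [isClosed_closure.isOpen_compl.mem_nhds h] with y hy
      exact ⟨fun hy' => absurd hy' hy, fun h' => absurd h' h⟩
  have h2 : ∀ᶠ y in 𝓝 x, y ∈ perforatedDomain Ω ↔ x ∈ perforatedDomain Ω := by
    filter_upwards [h0, eventually_all.2 h1] with y hy0 hy1
    simp only [perforatedDomain, Set.mem_sdiff, Set.mem_iUnion, hy0, hy1]
  by_cases h : x ∈ perforatedDomain Ω
  · refine hx.2 (mem_interior_iff_mem_nhds.2 ?_)
    filter_upwards [h2] with y hy using hy.2 h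
  · obtain ⟨y, hy, hy'⟩ := mem_closure_iff_frequently.1 hx.1 |>.and_eventually h2 |>.exists
    exact h (hy'.1 hy)

theorem frontier_hole_subset_compl_perforatedDomain (j : Fin N) :
    frontier (Ω j.succ) ⊆ (perforatedDomain Ω)ᶜ := fun _ hx hxD =>
  hxD.2 (Set.mem_iUnion.2 ⟨j, frontier_subset_closure hx⟩)

end Perforated

/-! ### Density of `𝒴` in `𝒳` -/

section Density

variable {N : ℕ} {Ω : Fin (N + 1) → Set Plane}

/-- A smooth cutoff, equal to one near the closure of the `i`-th hole and to zero near the closures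
of the other holes and outside the outer domain. -/
theorem IsHoleConfiguration.exists_cutoff (hΩ : IsHoleConfiguration Ω) (i : Fin N) :
    ∃ χ : Plane → ℝ, ContDiff ℝ ∞ χ ∧ (∀ j : Fin N, ∀ x ∈ closure (Ω j.succ), gradient χ x = 0) ∧
      ∀ j : Fin (N + 1), ∀ x ∈ frontier (Ω j), χ x = if j = i.succ then 1 else 0 := by
  set s : Set Plane := closure (Ω i.succ)
  set t : Set Plane := (Ω 0)ᶜ ∪ ⋃ j : {j : Fin N // j ≠ i}, closure (Ω j.1.succ)
  have ht : IsClosed t := (hΩ.smooth 0).isOpen.isClosed_compl.union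
    (isClosed_iUnion_of_finite fun _ => isClosed_closure)
  have hst : Disjoint t s := by
    refine Set.disjoint_union_left.2 ⟨?_, Set.disjoint_iUnion_left.2 fun j => hΩ.disjoint _ _ j.2⟩
    exact Set.disjoint_left.2 fun x hx hxs => hx (hΩ.closure_subset i hxs)
  obtain ⟨χ, h0, h1, -⟩ := exists_contMDiffMap_zero_one_nhds_of_isClosed (n := ⊤)
    (modelWithCornersSelf ℝ Plane) ht isClosed_closure hst
  rw [eventually_nhdsSet_iff_forall] at h0 h1
  have hconst : ∀ {x : Plane} {a : ℝ}, (∀ᶠ y in 𝓝 x, χ y = a) → gradient χ x = 0 := fun h => by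
    rw [EventuallyEq.gradient_eq (f := fun _ => _) h, gradient_fun_const]
  have hmem : ∀ j : Fin N, j ≠ i → closure (Ω j.succ) ⊆ t := fun j hj x hx =>
    Or.inr (Set.mem_iUnion.2 ⟨⟨j, hj⟩, hx⟩)
  refine ⟨χ, χ.contMDiff.contDiff, fun j x hx => ?_, fun j x hx => ?_⟩
  · by_cases hj : j = i
    · exact hconst (h1 x (hj ▸ hx))
    · exact hconst (h0 x (hmem j hj hx))
  · by_cases hj : j = i.succ
    · rw [if_pos hj]
      exact (h1 x (hj ▸ frontier_subset_closure hx)).self_of_nhds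
    · rw [if_neg hj]
      refine (h0 x ?_).self_of_nhds
      induction j using Fin.cases with
      | zero => exact Or.inl fun h => ((hΩ.smooth 0).isOpen.frontier_eq ▸ hx).2 h
      | succ j => exact hmem j (fun h => hj (h ▸ rfl)) (frontier_subset_closure hx)

theorem contDiff_holeHarmonic (i : Fin N) : ContDiff ℝ ∞ (holeHarmonic Ω i) := by
  unfold holeHarmonic
  split_ifs with h
  · exact h.choose_spec.contDiff
  · exact contDiff_const

/-- The boundary values of `holeHarmonic Ω i` on the perforated domain are attained by a smooth
function whose gradient vanishes on the boundaries of all holes. -/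
theorem IsHoleConfiguration.exists_contDiff_eq_holeHarmonic (hΩ : IsHoleConfiguration Ω)
    (i : Fin N) : ∃ χ : Plane → ℝ, ContDiff ℝ ∞ χ ∧
      (∀ j : Fin N, ∀ x ∈ frontier (Ω j.succ), gradient χ x = 0) ∧
      ∀ x ∈ frontier (perforatedDomain Ω), χ x = holeHarmonic Ω i x := by
  by_cases h : ∃ ζ : Plane → ℝ, IsHoleHarmonic Ω i ζ
  · obtain ⟨χ, h1, h2, h3⟩ := hΩ.exists_cutoff i
    refine ⟨χ, h1, fun j x hx => h2 j x (frontier_subset_closure hx), fun x hx => ?_⟩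
    obtain ⟨j, hj⟩ := exists_mem_frontier_of_mem_frontier_perforatedDomain hx
    rw [h3 j x hj, holeHarmonic, dif_pos h, h.choose_spec.boundary j x hj]
  -- Without a harmonic function with these boundary values, `holeHarmonic` takes its default value
  -- `0`, matched by `χ = 0`; solvability of the Dirichlet problem is therefore not needed.
  · exact ⟨0, contDiff_const, fun j x _ => gradient_const x 0, fun x _ => by
      rw [holeHarmonic, dif_neg h]⟩

/-- A smooth function belongs to `H²(D)` for every bounded open set `D`. -/
theorem memH2_of_contDiff {D : Set Plane} (hDo : IsOpen D) (hD : Bornology.IsBounded D)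
    {u : Plane → ℝ} (hu : ContDiff ℝ ∞ u) : MemH2 D u := by
  have hg := isWeakGrad_gradient hDo hD hu
  refine ⟨⟨_, hg⟩, fun k => ⟨gradient fun x => gradient u x k, ?_⟩⟩
  have hk : ContDiff ℝ ∞ fun x => gradient u x k :=
    contDiff_euclidean.1 (contDiff_gradient hu) k
  refine (isWeakGrad_gradient hDo hD hk).congr ?_ EventuallyEq.rfl
  filter_upwards [hg.weakGrad_ae_eq hDo] with x hx
  rw [hx]

/-- The flux of a smooth function through a part of the boundary on which its gradient vanishes is
zero. -/
theorem hasFlux_zero_of_contDiff {D Γ : Set Plane} (hDo : IsOpen D) (hD : Bornology.IsBounded D)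
    (hΓ : MeasurableSet Γ) {u : Plane → ℝ} (hu : ContDiff ℝ ∞ u)
    (h0 : ∀ x ∈ Γ, gradient u x = 0) : HasFlux D Γ u 0 := by
  -- The trace of the gradient is `0`, witnessed by the constant sequence formed by each partial
  -- derivative of `u`.
  refine ⟨0, fun k => ⟨(memH2_of_contDiff hDo hD hu).2 k, MemLp.zero', ?_⟩, by simp⟩
  have hk : ContDiff ℝ ∞ fun x => gradient u x k :=
    contDiff_euclidean.1 (contDiff_gradient hu) k
  refine ⟨fun _ x => gradient u x k, fun _ => hk, tendstoH1_const hDo hD hk ?_, ?_⟩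
  · filter_upwards [(isWeakGrad_gradient hDo hD hu).weakGrad_ae_eq hDo] with x hx
    rw [hx]
  · have : eLpNorm ((fun x => gradient u x k) - fun x => (0 : Plane → Plane) x k) 2
        (arcLength Γ) = 0 := by
      rw [eLpNorm_congr_ae (g := 0), eLpNorm_zero]
      filter_upwards [ae_restrict_mem hΓ] with x hx
      simp [h0 x hx]
    simp only [this, tendsto_const_nhds]

/-- `𝒴` is dense in `𝒳`, already through functions that are smooth up to the boundary. -/
theorem IsHoleConfiguration.exists_tendstoH1_of_mem_spaceX (hΩ : IsHoleConfiguration Ω)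
    {u : Plane → ℝ} (hu : u ∈ spaceX Ω) : ∃ f : ℕ → Plane → ℝ, (∀ n, ContDiff ℝ ∞ (f n)) ∧
      (∀ n, f n ∈ spaceY Ω) ∧ TendstoH1 (perforatedDomain Ω) f u := by
  set D := perforatedDomain Ω
  have hDo : IsOpen D := hΩ.isOpen_perforatedDomain
  have hD : Bornology.IsBounded D := hΩ.isBounded_perforatedDomain
  obtain ⟨-, v, θ, ⟨hv1, φ, hφ, hφv⟩, huv⟩ := hu
  choose χ hχ hχΓ hχD using hΩ.exists_contDiff_eq_holeHarmonic
  set X : Plane → ℝ := fun x => ∑ i, θ i * χ i x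
  set Z : Plane → ℝ := fun x => ∑ i, θ i * holeHarmonic Ω i x
  have hX : ContDiff ℝ ∞ X := ContDiff.sum fun i _ => contDiff_const.mul (hχ i)
  have hZ : ContDiff ℝ ∞ Z := ContDiff.sum fun i _ => contDiff_const.mul (contDiff_holeHarmonic i)
  have hXZ : ∀ x ∈ frontier D, X x = Z x := fun x hx =>
    Finset.sum_congr rfl fun i _ => by rw [hχD i x hx]
  have hXΓ : ∀ j : Fin N, ∀ x ∈ frontier (Ω j.succ), gradient X x = 0 := by
    intro j x hx
    have hd : HasFDerivAt X (∑ i, θ i • fderiv ℝ (χ i) x) x :=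
      HasFDerivAt.fun_sum fun i _ =>
        ((hχ i).differentiable (by simp) x).hasFDerivAt.const_mul (θ i)
    have h0 : ∀ i, (InnerProductSpace.toDual ℝ Plane).symm (fderiv ℝ (χ i) x) = 0 :=
      fun i => hχΓ i j x hx
    rw [gradient_eq_toDual_symm, hd.fderiv]
    simp [h0]
  obtain ⟨hw1, ψ, hψ, hψw⟩ := memH10_of_contDiff hDo hD (hZ.sub hX)
    (fun x hx => sub_eq_zero.2 (hXZ x hx).symm)
  have hf : ∀ n, ContDiff ℝ ∞ (φ n + ψ n + X) := fun n => ((hφ n).1.add (hψ n).1).add hX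
  have hXH1 : MemH1 D X := ⟨_, isWeakGrad_gradient hDo hD hX⟩
  have hvw : MemH1 D (v + fun x => Z x - X x) := ⟨_, hv1.isWeakGrad.add hw1.isWeakGrad⟩
  refine ⟨fun n => φ n + ψ n + X, hf, fun n => ⟨memH2_of_contDiff hDo hD (hf n), ?_, fun j => ?_⟩,
    ?_⟩
  -- The coefficients `θ` are those of `u`: `X` and `Z` agree on the boundary, so the remainder is
  -- smooth and vanishes there.
  · refine ⟨(memH2_of_contDiff hDo hD (hf n)).1, φ n + ψ n + X - Z, θ,
      memH10_of_contDiff hDo hD ((hf n).sub hZ) fun x hx => ?_,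
      Eventually.of_forall fun x => (sub_add_cancel ((φ n + ψ n + X) x) (Z x)).symm⟩
    simp [(hφ n).eq_zero_of_mem_frontier hDo hx, (hψ n).eq_zero_of_mem_frontier hDo hx, hXZ x hx]
  · refine hasFlux_zero_of_contDiff hDo hD isClosed_frontier.measurableSet (hf n) fun x hx => ?_
    have hxD := frontier_hole_subset_compl_perforatedDomain j hx
    change gradient (φ n + ψ n + X) x = 0
    rw [gradient_add_of_contDiff (f := φ n + ψ n) ((hφ n).1.add (hψ n).1) hX,
      gradient_add_of_contDiff (hφ n).1 (hψ n).1]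
    simp [(hφ n).gradient_eq_zero_of_notMem hxD, (hψ n).gradient_eq_zero_of_notMem hxD, hXΓ j x hx]
  · have h := ((hφv.add hDo (fun n => (hφ n).1) (fun n => (hψ n).1) hv1 hw1 hψw).add hDo
      (fun n => (hφ n).1.add (hψ n).1) (fun _ => hX) hvw hXH1
      (tendstoH1_const hDo hD hX EventuallyEq.rfl))
    refine h.congr_limit hDo ⟨_, hvw.choose_spec.add hXH1.choose_spec⟩ ?_
    filter_upwards [huv] with x hx
    rw [hx]
    change (v x + (Z x - X x)) + X x = v x + Z x
    ring

end Density

theorem corollary3p2 {N : ℕ} (Ω : Fin (N + 1) → Set Plane) (hΩ : IsHoleConfiguration Ω)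
    (c : Plane → ℝ) (hc : MemLp c ⊤ (volume.restrict (perforatedDomain Ω)))
    (hY : ∀ u ∈ spaceY Ω, 0 ≤ energy (perforatedDomain Ω) c u) :
    ∀ u ∈ spaceX Ω, 0 ≤ energy (perforatedDomain Ω) c u := by
  intro u hu
  have hDo := hΩ.isOpen_perforatedDomain
  obtain ⟨f, hf, hfY, hfu⟩ := hΩ.exists_tendstoH1_of_mem_spaceX hu
  refine ge_of_tendsto' (tendsto_energy hc (fun n => (hfY n).1.1) hu.1 hfu.1 ?_)
    fun n => hY (f n) (hfY n)
  -- `TendstoH1` uses the classical gradient of `f n`, the energy its chosen weak gradient; they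
  -- agree almost everywhere on the domain.
  refine hfu.2.congr fun n => eLpNorm_congr_ae (EventuallyEq.sub ?_ EventuallyEq.rfl)
  exact ((isWeakGrad_gradient hDo hΩ.isBounded_perforatedDomain (hf n)).weakGrad_ae_eq hDo).symm
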